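/- A lattice 3-polytope is a 3-dimensional polytope in $\mathbb{R}^3$ that is the convex hull of a finite subset of $\mathbb{Z}^3$; its size is its number of lattice points. For a lattice 3-polytope $P$ with $P\cap\mathbb{Z}^3=\{p_1,\dots,p_5\}$, there is, up to a scalar factor, a unique non-trivial affine dependence $\sum_i v_ip_i=0$, $\sum_i v_i=0$. Normalize it so that $|v_i|$ is the volume of $\operatorname{conv}\{p_j : j\neq i\}$, where the volume of $\operatorname{conv}\{q_1,\dots,q_4\}$ is $\left|\det\begin{pmatrix}1&\cdots&1\\ q_1&\cdots&q_4\end{pmatrix}\right|$; then $(v_1,\dots,v_5)\in\mathbb{Z}^5$ is the volume vector of $P$ for the given order of the points; it is determined up to a global sign. $P$ has signature $(4,1)$ if the dependence, up to sign, has four positive coefficients and one negative coefficient. Two polytopes are $\mathbb{Z}$-equivalent if an affine automorphism of $\mathbb{R}^3$ that maps $\mathbb{Z}^3$ onto itself carries one to the other. The width of $P$ with respect to an affine functional $f$ with $f(\mathbb{Z}^3)\subseteq\mathbb{Z}$ is $\max_P f-\min_P f$; the width of $P$ is the minimum of this number over all non-constant such $f$. **Theorem.** Let $P$ be a lattice 3-polytope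 of size five and signature $(4,1)$ whose volume vector, for a suitable order of the lattice points, is $(q,q,q,q,-4q)$ with $q$ a non-negative integer. Then one of the following holds: 1. $q=1$ and $P$ is $\mathbb{Z}$-equivalent to $Q_1=\operatorname{conv}\{(0,0,0),(1,0,0),(0,0,1),(1,1,1),(-2,-1,-2)\}$; 2. $q=5$ and $P$ is $\mathbb{Z}$-equivalent to $Q_5=\operatorname{conv}\{(0,0,0),(1,0,0),(0,0,1),(2,5,1),(-3,-5,-2)\}$. In each of $Q_1$ and $Q_5$ the five listed points are distinct and are exactly the lattice points, and, in the listed order, the volume vectors are $(-4,1,1,1,1)$ and $(-20,5,5,5,5)$ respectively. Both $Q_1$ and $Q_5$ have width two, and both have width two with respect to the functional $(x,y,z)\mapsto x-z$, which takes integer values on $\mathbb{Z}^3$. -/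

import Mathlib

/-- The inclusion of `ℤ^d` into `ℝ^d`. -/
def toReal {d : ℕ} (z : Fin d → ℤ) : Fin d → ℝ := fun i => (z i : ℝ)

/-- The integer lattice `ℤ^d` as a subset of `ℝ^d`. -/
def intLattice (d : ℕ) : Set (Fin d → ℝ) := Set.range (toReal (d := d))

/-- A lattice polytope: the convex hull of a finite set of points of `ℤ^d`. -/
def IsLatticePolytope {d : ℕ} (P : Set (Fin d → ℝ)) : Prop :=
  ∃ S : Finset (Fin d → ℤ), P = convexHull ℝ (toReal '' (S : Set (Fin d → ℤ)))

/-- `P ⊆ ℝ^d` is `d`-dimensional: it contains `d + 1` affinely independent points. -/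
def IsFullDimensional {d : ℕ} (P : Set (Fin d → ℝ)) : Prop :=
  ∃ p : Fin (d + 1) → (Fin d → ℝ), AffineIndependent ℝ p ∧ ∀ i, p i ∈ P

/-- The size of `P`: its number of lattice points. -/
noncomputable def latticeSize {d : ℕ} (P : Set (Fin d → ℝ)) : ℕ :=
  (P ∩ intLattice d).ncard

/-- `a` lists the lattice points of `P`, without repetition. -/
def IsLatticePointList {d n : ℕ} (P : Set (Fin d → ℝ)) (a : Fin n → (Fin d → ℤ)) : Prop :=
  Function.Injective a ∧ Set.range (fun i => toReal (a i)) = P ∩ intLattice d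

/-- `c` is the coefficient vector of an affine dependence among the points `a`. -/
def IsAffineDependence {d n : ℕ} (a : Fin n → (Fin d → ℤ)) (c : Fin n → ℝ) : Prop :=
  ∑ i, c i = 0 ∧ ∑ i, c i • toReal (a i) = 0

/-- The normalized volume of the (perhaps degenerate) simplex with vertices `p`: the absolute
value of the determinant with columns `(1, p j)`. -/
def simplexVolume {d : ℕ} (p : Fin (d + 1) → (Fin d → ℤ)) : ℤ :=
  |Matrix.det (Matrix.of fun i j : Fin (d + 1) => (Fin.cons 1 (p j) : Fin (d + 1) → ℤ) i)|

/-- `v` is the volume vector of the `d + 2` ordered points `a`: an affine dependence among them,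
normalized so that `|v k|` is the normalized volume of the simplex spanned by the points other
than `a k`. For affinely spanning points it is unique up to a global sign. -/
def IsVolumeVector {d : ℕ} (a : Fin (d + 2) → (Fin d → ℤ)) (v : Fin (d + 2) → ℤ) : Prop :=
  IsAffineDependence a (fun k => (v k : ℝ)) ∧
    ∀ k, |v k| = simplexVolume (fun j => a (k.succAbove j))

/-- `P` has `d + 2` lattice points, and `v` is their volume vector in a suitable order. -/
def HasVolumeVector {d : ℕ} (P : Set (Fin d → ℝ)) (v : Fin (d + 2) → ℤ) : Prop :=
  ∃ a : Fin (d + 2) → (Fin d → ℤ), IsLatticePointList P a ∧ IsVolumeVector a v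

/-- `P` has `d + 2` lattice points, and they have an affine dependence, not identically zero, with
`i` positive and `j` negative coefficients. (For a `d`-dimensional lattice polytope `P` the
dependence is unique up to a scalar factor; changing its sign exchanges `i` and `j`.) -/
def HasSignature {d : ℕ} (P : Set (Fin d → ℝ)) (i j : ℕ) : Prop :=
  ∃ (a : Fin (d + 2) → (Fin d → ℤ)) (c : Fin (d + 2) → ℝ),
    IsLatticePointList P a ∧ IsAffineDependence a c ∧ c ≠ 0 ∧
      {k | 0 < c k}.ncard = i ∧ {k | c k < 0}.ncard = j

/-- `ℤ`-equivalence: an affine automorphism of `ℝ^d` that maps `ℤ^d` onto itself (hence is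
unimodular: its linear part has determinant `1` or `-1`) carries `P` to `Q`. -/
def ZEquivalent {d : ℕ} (P Q : Set (Fin d → ℝ)) : Prop :=
  ∃ t : (Fin d → ℝ) ≃ᵃ[ℝ] (Fin d → ℝ), t '' intLattice d = intLattice d ∧ t '' P = Q

/-- `f` is an integer affine functional: `f (ℤ^d) ⊆ ℤ`. -/
def IsIntegerFunctional {d : ℕ} (f : (Fin d → ℝ) →ᵃ[ℝ] ℝ) : Prop :=
  ∀ x ∈ intLattice d, ∃ n : ℤ, f x = n

/-- `w = max_P f - min_P f` is the width of `P` with respect to `f`. -/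
def HasWidthWrt {d : ℕ} (P : Set (Fin d → ℝ)) (f : (Fin d → ℝ) →ᵃ[ℝ] ℝ) (w : ℝ) : Prop :=
  ∃ M m : ℝ, IsGreatest (f '' P) M ∧ IsLeast (f '' P) m ∧ w = M - m

/-- `w` is the width of `P`: the minimum of its widths with respect to all non-constant integer
affine functionals. -/
def HasWidth {d : ℕ} (P : Set (Fin d → ℝ)) (w : ℝ) : Prop :=
  IsLeast {u : ℝ | ∃ f : (Fin d → ℝ) →ᵃ[ℝ] ℝ,
    IsIntegerFunctional f ∧ (∃ x y, f x ≠ f y) ∧ HasWidthWrt P f u} w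

/-- The convex hull of a list of lattice points. -/
def latticeHull {d n : ℕ} (a : Fin n → (Fin d → ℤ)) : Set (Fin d → ℝ) :=
  convexHull ℝ (Set.range fun i => toReal (a i))

def configOne : Fin 5 → (Fin 3 → ℤ) :=
  ![![0, 0, 0], ![1, 0, 0], ![0, 0, 1], ![1, 1, 1], ![-2, -1, -2]]

def configFive : Fin 5 → (Fin 3 → ℤ) :=
  ![![0, 0, 0], ![1, 0, 0], ![0, 0, 1], ![2, 5, 1], ![-3, -5, -2]]

/-- The functional `(x, y, z) ↦ x - z` on `ℝ³`. -/
noncomputable def functionalXZ : (Fin 3 → ℝ) →ᵃ[ℝ] ℝ :=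
  (LinearMap.proj (R := ℝ) (φ := fun _ : Fin 3 => ℝ) 0 -
    LinearMap.proj (R := ℝ) (φ := fun _ : Fin 3 => ℝ) 2).toAffineMap

/-! Translate the point with coefficient `-4q` to the origin. The other four points become vectors
`r 0, …, r 3` with sum zero. Their tetrahedron contains no lattice points except its vertices and
its centroid `0`, and any three of the vectors have determinant `±q`. The task is to show `q = 1` or
`q = 5` and to recover the vectors up to a unimodular map.

Size: the edge midpoints of the tetrahedron span an octahedron symmetric about `0`, of volume `q /
3`. Its interior contains no nonzero lattice point, so Minkowski's theorem gives `q ≤ 24`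
(`IsCentredSimplex.abs_det_le`).

Primes: if `p ∣ q`, some `∑ wᵢ rᵢ` lies in `p ℤ³` with `w` not constant modulo `p`. Since `∑ rᵢ =
0`, each `k w + t` is such a relation too. If its residues in `[0, p)` have sum at most `p`,
dividing by `p` gives a forbidden lattice point of the tetrahedron. A finite check finds suitable `k
≠ 0` and `t` for every `w` and every prime `p ≤ 24` except `5`. For `p = 5` the only exceptions are
the `w` with four distinct residues, which can be normalized to `0, 1, 2, 3`.

As `25 > 24`, only `q = 1` and `q = 5` remain. For `q = 1` three of the vectors are a lattice basis;
for `q = 5` the relation supplies the missing basis vector. -/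

/-! ### Coefficients of lattice points in a centred simplex -/

/-- Four lattice vectors spanning `ℝ³`, with centroid the origin, such that the simplex spanned by
them contains no lattice points besides its vertices and the origin. -/
structure IsCentredSimplex (r : Fin 4 → Fin 3 → ℤ) : Prop where
  sum_eq_zero : ∑ i, r i = 0
  det_ne_zero : (Matrix.of ![r 0, r 1, r 2]).det ≠ 0
  eq_of_mem : ∀ x : Fin 3 → ℤ, toReal x ∈ convexHull ℝ (Set.range fun i => toReal (r i)) →
    x = 0 ∨ ∃ i, x = r i

namespace IsCentredSimplex

variable {r : Fin 4 → Fin 3 → ℤ}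

theorem apply_three (h : IsCentredSimplex r) (j : Fin 3) :
    r 3 j = -(r 0 j + r 1 j + r 2 j) := by
  have := congrFun h.sum_eq_zero j
  simp [Fin.sum_univ_four] at this
  linarith

theorem eq_zero_of_sum (h : IsCentredSimplex r) (c : Fin 3 → ℝ)
    (hc : ∀ j, c 0 * r 0 j + c 1 * r 1 j + c 2 * r 2 j = 0) : c = 0 := by
  refine Matrix.eq_zero_of_vecMul_eq_zero
    (M := (Matrix.of ![r 0, r 1, r 2]).map (Int.castRingHom ℝ)) ?_ ?_
  · have := h.det_ne_zero
    rw [← RingHom.mapMatrix_apply, ← RingHom.map_det]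
    simpa using this
  · funext j
    have := hc j
    simp only [Matrix.vecMul, dotProduct, Fin.sum_univ_three]
    simpa using this

/-- The linear relations among the four vectors are the multiples of `∑ rᵢ = 0`, so coefficients are
unique up to a common constant; subtracting the last one removes it. -/
theorem sub_eq_of_sum_eq (h : IsCentredSimplex r) (w m : Fin 4 → ℝ)
    (hw : ∀ j, ∑ i, w i * r i j = ∑ i, m i * r i j) (i : Fin 4) : w i - w 3 = m i - m 3 := by
  have key := h.eq_zero_of_sum (fun i => (w i.castSucc - w 3) - (m i.castSucc - m 3)) (by
    intro j
    have h1 := hw j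
    have h2 : (r 3 j : ℝ) = -(r 0 j + r 1 j + r 2 j) := by exact_mod_cast h.apply_three j
    simp only [Fin.sum_univ_four, h2] at h1
    have e0 : (Fin.castSucc 0 : Fin 4) = 0 := rfl
    have e1 : (Fin.castSucc 1 : Fin 4) = 1 := rfl
    have e2 : (Fin.castSucc 2 : Fin 4) = 2 := rfl
    simp only [e0, e1, e2]
    linear_combination h1)
  have k0 := congrFun key 0
  have k1 := congrFun key 1
  have k2 := congrFun key 2
  have e0 : (Fin.castSucc 0 : Fin 4) = 0 := rfl
  have e1 : (Fin.castSucc 1 : Fin 4) = 1 := rfl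
  have e2 : (Fin.castSucc 2 : Fin 4) = 2 := rfl
  simp only [e0, e1, e2, Pi.zero_apply] at k0 k1 k2
  fin_cases i <;> simp <;> linarith

/-- The missing weight `1 - ∑ wᵢ` can be spread equally over the vertices without moving the point,
because the centroid is `0`. The point is then in the simplex, so it is `0` or a vertex, and `m` is
zero or a unit vector. -/
theorem exists_int_of_mem (h : IsCentredSimplex r) (w : Fin 4 → ℝ) (hw : ∀ i, 0 ≤ w i)
    (hw1 : ∑ i, w i ≤ 1) (x : Fin 3 → ℤ) (hx : ∀ j, (x j : ℝ) = ∑ i, w i * r i j) :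
    ∃ m : Fin 4 → ℤ, ∀ i, w i - w 3 = m i - m 3 := by
  have h0 : ∀ j, ∑ i, (r i j : ℝ) = 0 := by
    intro j
    have := congrFun h.sum_eq_zero j
    simp only [Finset.sum_apply, Pi.zero_apply] at this
    exact_mod_cast this
  have hmem : toReal x ∈ convexHull ℝ (Set.range fun i => toReal (r i)) := by
    have : toReal x = ∑ i, (w i + (1 - ∑ i, w i) / 4) • toReal (r i) := by
      funext j
      simp only [Finset.sum_apply, Pi.smul_apply, smul_eq_mul, toReal, add_mul,
        Finset.sum_add_distrib, ← Finset.mul_sum, h0, hx]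
      simp
    rw [this]
    refine (convex_convexHull ℝ _).sum_mem (fun i _ => ?_) ?_
      (fun i _ => subset_convexHull ℝ _ ⟨i, rfl⟩)
    · have := hw i
      linarith
    · simp only [Finset.sum_add_distrib, Finset.sum_const, Finset.card_univ, Fintype.card_fin]
      ring
  rcases h.eq_of_mem x hmem with rfl | ⟨k, rfl⟩
  · refine ⟨0, h.sub_eq_of_sum_eq w (fun i => ((0 : Fin 4 → ℤ) i : ℝ)) fun j => ?_⟩
    rw [← hx j]
    simp
  · refine ⟨Pi.single k 1, h.sub_eq_of_sum_eq w (fun i => ((Pi.single k 1 : Fin 4 → ℤ) i : ℝ))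
      fun j => ?_⟩
    rw [← hx j]
    simp [Pi.single_apply]

/-- The relation `∑ wᵢ rᵢ ∈ n ℤ³` is preserved by affine maps `w ↦ k w + t` modulo `n`. -/
theorem exists_shift {n : ℤ} (h : IsCentredSimplex r) {w : Fin 4 → ℤ}
    (hw : ∃ x : Fin 3 → ℤ, ∑ i, w i • r i = n • x) (k t : ℤ) {w' : Fin 4 → ℤ}
    (hw' : ∀ i, w' i ≡ k * w i + t [ZMOD n]) : ∃ x : Fin 3 → ℤ, ∑ i, w' i • r i = n • x := by
  obtain ⟨x, hx⟩ := hw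
  choose y hy using fun i => (hw' i).dvd
  refine ⟨k • x - ∑ i, y i • r i, ?_⟩
  have : ∀ i, w' i • r i = k • (w i • r i) + t • r i - n • (y i • r i) := by
    intro i
    have : w' i = k * w i + t - n * y i := by linarith [hy i]
    rw [this]
    module
  simp_rw [this, Finset.sum_sub_distrib, Finset.sum_add_distrib, ← Finset.smul_sum, hx,
    h.sum_eq_zero]
  module

theorem dvd_sub_of_sum_le {n : ℤ} (hn : 0 < n) (h : IsCentredSimplex r) {w : Fin 4 → ℤ}
    (hw : ∃ x : Fin 3 → ℤ, ∑ i, w i • r i = n • x) (h0 : ∀ i, 0 ≤ w i) (h1 : ∑ i, w i ≤ n)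
    (i : Fin 4) : n ∣ w i - w 3 := by
  obtain ⟨x, hx⟩ := hw
  have hn' : (0 : ℝ) < n := by exact_mod_cast hn
  obtain ⟨m, hm⟩ := h.exists_int_of_mem (fun i => w i / n)
    (fun i => div_nonneg (by exact_mod_cast h0 i) hn'.le)
    (by rw [← Finset.sum_div, div_le_one hn']; exact_mod_cast h1) x (fun j => by
      have := congrFun hx j
      simp only [Finset.sum_apply, Pi.smul_apply, smul_eq_mul] at this
      have h2 : ∑ i, (w i : ℝ) * r i j = n * x j := by exact_mod_cast this
      simp_rw [div_mul_eq_mul_div, ← Finset.sum_div, h2]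
      field_simp)
  refine ⟨m i - m 3, ?_⟩
  have := hm i
  field_simp at this
  exact_mod_cast this

end IsCentredSimplex

/-! ### Prime divisors of the determinant -/

/-- The points of `𝔽ₚ³ ∖ {0}` up to scaling. -/
def projectivePlanePoints (p : ℕ) : List (ℕ × ℕ × ℕ) :=
  (List.range p).flatMap (fun b => (List.range p).map fun c => (1, b, c)) ++
    (List.range p).map (fun c => (0, 1, c)) ++ [(0, 0, 1)]

/-- The list consists of the primes up to 24 other than 5. The fourth coefficient is normalized to
`0`, so its residue after the shift is the last summand `t`. -/
theorem exists_residues_sum_le_of_ne_five : ∀ p ∈ [2, 3, 7, 11, 13, 17, 19, 23],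
    ∀ v ∈ projectivePlanePoints p, ∃ k < p, k ≠ 0 ∧ ∃ t < p,
      (k * v.1 + t) % p + (k * v.2.1 + t) % p + (k * v.2.2 + t) % p + t ≤ p := by
  decide +kernel

/-- Four distinct residues modulo 5 omit exactly one, so their sum is at least 6, also after any
invertible affine map. In the second alternative `k ≠ 0` is automatic, since the resulting residues
are distinct. -/
theorem exists_residues_sum_le_or_perm_five : ∀ v ∈ projectivePlanePoints 5,
    (∃ k < 5, k ≠ 0 ∧ ∃ t < 5,
      (k * v.1 + t) % 5 + (k * v.2.1 + t) % 5 + (k * v.2.2 + t) % 5 + t ≤ 5) ∨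
    ∃ k < 5, ∃ t < 5, ∃ σ : Equiv.Perm (Fin 4), ∀ i : Fin 4,
      (k * (![v.1, v.2.1, v.2.2, 0] (σ i)) + t) % 5 = (i : ℕ) := by
  decide +kernel

theorem exists_mul_modEq_one {p : ℕ} (hp : p.Prime) {a : ℤ} (ha : ¬(p : ℤ) ∣ a) :
    ∃ u : ℤ, ¬(p : ℤ) ∣ u ∧ u * a ≡ 1 [ZMOD p] := by
  have hc : IsCoprime (p : ℤ) a := (Nat.prime_iff_prime_int.mp hp).coprime_iff_not_dvd.mpr ha
  obtain ⟨s, u, hu⟩ := hc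
  have h1 : u * a ≡ 1 [ZMOD p] := (Int.modEq_iff_dvd).mpr ⟨s, by linarith⟩
  refine ⟨u, fun hd => ?_, h1⟩
  have h2 : (p : ℤ) ∣ 1 := by
    rw [← hu]
    exact dvd_add (Dvd.intro_left _ rfl) (hd.mul_right _)
  exact (Nat.prime_iff_prime_int.mp hp).not_isUnit (isUnit_of_dvd_one h2)

theorem exists_natCast_modEq {p : ℕ} (hp : 0 < p) (a : ℤ) : ∃ n < p, (n : ℤ) ≡ a [ZMOD p] := by
  have h0 : (0 : ℤ) < p := by exact_mod_cast hp
  refine ⟨(a % p).toNat, ?_, ?_⟩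
  · have := Int.emod_lt_of_pos a h0
    have := Int.emod_nonneg a h0.ne'
    omega
  · rw [Int.toNat_of_nonneg (Int.emod_nonneg a h0.ne')]
    exact Int.mod_modEq a p

/-- Subtracting `w 3` kills the last entry; multiplying by the inverse of the first entry that is
nonzero modulo `p` makes that entry `1`. -/
theorem exists_mem_projectivePlanePoints {p : ℕ} (hp : p.Prime) (w : Fin 4 → ℤ)
    (hw : ∃ i, ¬(p : ℤ) ∣ w i - w 3) :
    ∃ v ∈ projectivePlanePoints p, ∃ u s : ℤ, ¬(p : ℤ) ∣ u ∧
      ∀ i, ((![v.1, v.2.1, v.2.2, 0] i : ℕ) : ℤ) ≡ u * w i + s [ZMOD p] := by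
  have hmul : ∀ u i, u * (w i - w 3) = u * w i + -(u * w 3) := fun u i => by ring
  have hdvd : ∀ u i, (p : ℤ) ∣ w i - w 3 → 0 ≡ u * w i + -(u * w 3) [ZMOD p] := by
    intro u i hi
    rw [← hmul]
    exact (Int.modEq_zero_iff_dvd.mpr (hi.mul_left u)).symm
  have h3 : ∀ u, 0 ≡ u * w 3 + -(u * w 3) [ZMOD p] := fun u => hdvd u 3 (by simp)
  by_cases h0 : (p : ℤ) ∣ w 0 - w 3
  · by_cases h1 : (p : ℤ) ∣ w 1 - w 3
    · have h2 : ¬(p : ℤ) ∣ w 2 - w 3 := by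
        obtain ⟨i, hi⟩ := hw
        fin_cases i
        · exact absurd h0 hi
        · exact absurd h1 hi
        · exact hi
        · simp at hi
      obtain ⟨u, hu, hu1⟩ := exists_mul_modEq_one hp h2
      rw [hmul] at hu1
      refine ⟨(0, 0, 1), by simp [projectivePlanePoints], u, -(u * w 3), hu, fun i => ?_⟩
      fin_cases i
      · exact hdvd u 0 h0
      · exact hdvd u 1 h1
      · exact hu1.symm
      · exact h3 u
    · obtain ⟨u, hu, hu1⟩ := exists_mul_modEq_one hp h1
      rw [hmul] at hu1
      obtain ⟨c, hc, hc'⟩ := exists_natCast_modEq hp.pos (u * w 2 + -(u * w 3))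
      refine ⟨(0, 1, c), by simp [projectivePlanePoints, hc], u, -(u * w 3), hu, fun i => ?_⟩
      fin_cases i
      · exact hdvd u 0 h0
      · exact hu1.symm
      · exact hc'
      · exact h3 u
  · obtain ⟨u, hu, hu1⟩ := exists_mul_modEq_one hp h0
    rw [hmul] at hu1
    obtain ⟨b, hb, hb'⟩ := exists_natCast_modEq hp.pos (u * w 1 + -(u * w 3))
    obtain ⟨c, hc, hc'⟩ := exists_natCast_modEq hp.pos (u * w 2 + -(u * w 3))
    refine ⟨(1, b, c), by simp [projectivePlanePoints, hb, hc], u, -(u * w 3), hu, fun i => ?_⟩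
    fin_cases i
    · exact hu1.symm
    · exact hb'
    · exact hc'
    · exact h3 u

/-- A left kernel vector of the matrix modulo `p`, lifted to `ℤ` and extended by `w 3 = 0`; being
nonzero then means being nonconstant modulo `p`. -/
theorem exists_relation_of_prime_dvd_det (r : Fin 4 → Fin 3 → ℤ) {p : ℕ} (hp : p.Prime)
    (hd : (p : ℤ) ∣ (Matrix.of ![r 0, r 1, r 2]).det) :
    ∃ w : Fin 4 → ℤ, (∃ i, ¬(p : ℤ) ∣ w i - w 3) ∧
      ∃ x : Fin 3 → ℤ, ∑ i, w i • r i = (p : ℤ) • x := by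
  have := Fact.mk hp
  have h0 : ((Matrix.of ![r 0, r 1, r 2]).map (Int.castRingHom (ZMod p))).det = 0 := by
    rw [← RingHom.mapMatrix_apply, ← RingHom.map_det]
    exact (ZMod.intCast_zmod_eq_zero_iff_dvd _ _).mpr hd
  obtain ⟨c, hc, hc0⟩ := Matrix.exists_vecMul_eq_zero_iff.mpr h0
  choose a ha using fun i => ZMod.intCast_surjective (c i)
  refine ⟨![a 0, a 1, a 2, 0], ?_, ?_⟩
  · by_contra! hcon
    refine hc (funext fun i => ?_)
    rw [← ha i]
    refine (ZMod.intCast_zmod_eq_zero_iff_dvd _ _).mpr ?_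
    have := hcon i.castSucc
    fin_cases i <;> simpa using this
  · have : ∀ j, (p : ℤ) ∣ a 0 * r 0 j + a 1 * r 1 j + a 2 * r 2 j := by
      intro j
      refine (ZMod.intCast_zmod_eq_zero_iff_dvd _ _).mp ?_
      have := congrFun hc0 j
      simp only [Matrix.vecMul, dotProduct, Fin.sum_univ_three] at this
      simpa [ha] using this
    choose x hx using this
    refine ⟨x, funext fun j => ?_⟩
    simpa [Fin.sum_univ_four] using hx j

namespace IsCentredSimplex

variable {r : Fin 4 → Fin 3 → ℤ}

/-- A small residue sum would force `p ∣ k * u * (w i - w 3)` for all `i`, whereas `p` divides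
neither `k` nor `u`, and for some `i` not the last factor. -/
theorem not_residues_sum_le (h : IsCentredSimplex r) {p : ℕ} (hp : p.Prime) {w : Fin 4 → ℤ}
    (hw : ∃ i, ¬(p : ℤ) ∣ w i - w 3) (hr : ∃ x : Fin 3 → ℤ, ∑ i, w i • r i = (p : ℤ) • x)
    {v : ℕ × ℕ × ℕ} {u s : ℤ} (hu : ¬(p : ℤ) ∣ u)
    (hv : ∀ i, ((![v.1, v.2.1, v.2.2, 0] i : ℕ) : ℤ) ≡ u * w i + s [ZMOD p]) :
    ¬∃ k < p, k ≠ 0 ∧ ∃ t < p,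
      (k * v.1 + t) % p + (k * v.2.1 + t) % p + (k * v.2.2 + t) % p + t ≤ p := by
  rintro ⟨k, hk, hk0, t, ht, hsum⟩
  have hp0 : (0 : ℤ) < p := by exact_mod_cast hp.pos
  set w' : Fin 4 → ℤ := fun i => (((k * (![v.1, v.2.1, v.2.2, 0] i) + t) % p : ℕ) : ℤ) with hw'
  have hcong : ∀ i, w' i ≡ (k * u) * w i + (k * s + t) [ZMOD p] := by
    intro i
    have e : (k * u) * w i + (k * s + t) = k * (u * w i + s) + t := by ring
    rw [e]
    refine Int.ModEq.trans ?_ (((hv i).mul_left k).add_right t)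
    simp only [hw', Int.natCast_mod]
    push_cast
    exact Int.mod_modEq _ _
  have hdvd := h.dvd_sub_of_sum_le hp0 (h.exists_shift hr _ _ hcong) (fun i => by positivity) (by
    simp only [hw', Fin.sum_univ_four]
    norm_cast
    simpa [Nat.mod_eq_of_lt ht] using hsum)
  obtain ⟨i, hi⟩ := hw
  have h1 : (p : ℤ) ∣ k * u * (w i - w 3) := by
    have e := (hcong i).sub (hcong 3)
    have e2 := (Int.modEq_zero_iff_dvd.mpr (hdvd i)).symm.trans e
    have := Int.modEq_zero_iff_dvd.mp e2.symm
    convert this using 1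
    ring
  have hP := Nat.prime_iff_prime_int.mp hp
  rcases hP.dvd_or_dvd h1 with h2 | h2
  · rcases hP.dvd_or_dvd h2 with h3 | h3
    · exact hk0 (Nat.eq_zero_of_dvd_of_lt (Int.natCast_dvd_natCast.mp h3) hk)
    · exact hu h3
  · exact hi h2

theorem eq_five_of_prime_dvd (h : IsCentredSimplex r) {p : ℕ} (hp : p.Prime) (hp' : p ≤ 24)
    (hd : (p : ℤ) ∣ (Matrix.of ![r 0, r 1, r 2]).det) : p = 5 := by
  by_contra h5
  have hmem : p ∈ [2, 3, 7, 11, 13, 17, 19, 23] := by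
    interval_cases p <;> first | (exfalso; revert hp; norm_num; done) | simp_all
  obtain ⟨w, hw, hr⟩ := exists_relation_of_prime_dvd_det r hp hd
  obtain ⟨v, hv, u, s, hu, hvw⟩ := exists_mem_projectivePlanePoints hp w hw
  exact h.not_residues_sum_le hp hw hr hu hvw (exists_residues_sum_le_of_ne_five p hmem v hv)

theorem exists_perm_relation_five (h : IsCentredSimplex r)
    (hd : 5 ∣ (Matrix.of ![r 0, r 1, r 2]).det) :
    ∃ (σ : Equiv.Perm (Fin 4)) (x : Fin 3 → ℤ),
      r (σ 1) + (2 : ℤ) • r (σ 2) + (3 : ℤ) • r (σ 3) = (5 : ℤ) • x := by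
  obtain ⟨w, hw, hr⟩ := exists_relation_of_prime_dvd_det r Nat.prime_five hd
  obtain ⟨v, hv, u, s, hu, hvw⟩ := exists_mem_projectivePlanePoints Nat.prime_five w hw
  obtain ⟨k, -, t, -, σ, hσ⟩ := (exists_residues_sum_le_or_perm_five v hv).resolve_left
    (h.not_residues_sum_le Nat.prime_five hw hr hu hvw)
  have hcong : ∀ i, ((σ.symm i : ℕ) : ℤ) ≡ (k * u) * w i + (k * s + t) [ZMOD (5 : ℕ)] := by
    intro i
    have e : (k * u) * w i + (k * s + t) = k * (u * w i + s) + t := by ring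
    rw [e]
    refine Int.ModEq.trans ?_ (((hvw i).mul_left k).add_right t)
    have := hσ (σ.symm i)
    rw [Equiv.apply_symm_apply] at this
    rw [← this, Int.natCast_mod]
    push_cast
    exact Int.mod_modEq _ _
  obtain ⟨x, hx⟩ := h.exists_shift hr _ _ hcong
  refine ⟨σ, x, ?_⟩
  rw [← Equiv.sum_comp σ] at hx
  simpa [Fin.sum_univ_four] using hx

end IsCentredSimplex

/-! ### Minkowski bound on the determinant -/

open MeasureTheory in
theorem volume_sum_abs_lt_one :
    volume {t : Fin 3 → ℝ | ∑ i, |t i| < 1} = ENNReal.ofReal (4 / 3) := by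
  have := volume_sum_rpow_lt_one (Fin 3) (p := 1) le_rfl
  simp only [Real.rpow_one, div_one] at this
  rw [this]
  have h2 : Real.Gamma (1 + 1) = 1 := by
    have := Real.Gamma_nat_eq_factorial 1
    norm_num at this ⊢
  have h4 : Real.Gamma (Fintype.card (Fin 3) + 1) = 6 := by
    rw [Real.Gamma_nat_eq_factorial]
    simp [Nat.factorial]
  rw [h2, h4]
  norm_num

open MeasureTheory Module in
/-- Minkowski's theorem for the image of the cross-polytope under a linear map. -/
theorem exists_int_combination_of_det (M : Matrix (Fin 3) (Fin 3) ℝ) (hM : 6 < |M.det|) :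
    ∃ (x : Fin 3 → ℤ) (t : Fin 3 → ℝ), x ≠ 0 ∧ ∑ i, |t i| < 1 ∧ toReal x = M.mulVec t := by
  classical
  set B : Set (Fin 3 → ℝ) := {t | ∑ i, |t i| < 1} with hB
  have hconv : Convex ℝ B := by
    have : ConvexOn ℝ Set.univ fun t : Fin 3 → ℝ => ∑ i, |t i| := by
      refine ⟨convex_univ, fun x _ y _ a b ha hb _ => ?_⟩
      simp only [smul_eq_mul, Finset.mul_sum, ← Finset.sum_add_distrib, Pi.add_apply,
        Pi.smul_apply]
      refine Finset.sum_le_sum fun i _ => (abs_add_le _ _).trans ?_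
      rw [abs_mul, abs_mul, abs_of_nonneg ha, abs_of_nonneg hb]
    simpa [hB] using this.convex_lt 1
  let b := Pi.basisFun ℝ (Fin 3)
  have hvol : volume (ZSpan.fundamentalDomain b) = 1 := by
    rw [ZSpan.volume_fundamentalDomain]
    have : Matrix.of b = 1 := by
      ext i j
      simp [b, Matrix.one_apply, Pi.single_apply, eq_comm]
    simp [this]
  have : Countable (Submodule.span ℤ (Set.range b)).toAddSubgroup :=
    inferInstanceAs (Countable (Submodule.span ℤ (Set.range b)))
  have hfund := ZSpan.isAddFundamentalDomain' b (volume : Measure (Fin 3 → ℝ))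
  obtain ⟨x, hx0, t, ht, hxt⟩ := exists_ne_zero_mem_lattice_of_measure_mul_two_pow_lt_measure
    (s := (Matrix.toLin' M) '' B) hfund
    (by
      rintro _ ⟨t, ht, rfl⟩
      exact ⟨-t, by simpa [hB] using ht, map_neg _ _⟩)
    (hconv.linear_image _)
    (by
      rw [hvol, Measure.addHaar_image_linearMap, volume_sum_abs_lt_one, LinearMap.det_toLin',
        ← ENNReal.ofReal_mul (abs_nonneg _), one_mul, finrank_fin_fun]
      -- Minkowski's condition reads `8 < |det M| * 4 / 3`, which is `6 < |det M|`.
      rw [show (2 : ENNReal) ^ 3 = ENNReal.ofReal 8 by norm_num]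
      rw [ENNReal.ofReal_lt_ofReal_iff (by linarith)]
      linarith)
  have hx := x.2
  have : ∀ i, ∃ n : ℤ, (n : ℝ) = (x : Fin 3 → ℝ) i := by
    intro i
    have := (b.mem_span_iff_repr_mem ℤ (x : Fin 3 → ℝ)).mp hx i
    simpa [b] using this
  choose n hn using this
  refine ⟨n, t, ?_, ht, ?_⟩
  · rintro rfl
    apply hx0
    ext i
    simp [← hn i]
  · rw [← Matrix.toLin'_apply, hxt]
    exact funext hn

theorem IsCentredSimplex.abs_det_le {r : Fin 4 → Fin 3 → ℤ} (h : IsCentredSimplex r) :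
    |(Matrix.of ![r 0, r 1, r 2]).det| ≤ 24 := by
  by_contra! hlt
  -- The columns are midpoints of three edges; the opposite edges have the negated midpoints since
  -- `∑ rᵢ = 0`. So `M` maps the cross-polytope to the octahedron of edge midpoints.
  set M : Matrix (Fin 3) (Fin 3) ℝ := Matrix.of fun j =>
    ![((r 0 j : ℝ) + r 1 j) / 2, ((r 0 j : ℝ) + r 2 j) / 2, ((r 1 j : ℝ) + r 2 j) / 2] with hM
  have hdet : M.det = -((Matrix.of ![r 0, r 1, r 2]).det : ℝ) / 4 := by
    simp [hM, Matrix.det_fin_three]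
    ring
  have hlt' : (24 : ℝ) < |((Matrix.of ![r 0, r 1, r 2]).det : ℝ)| := by exact_mod_cast hlt
  obtain ⟨x, t, hx, ht, hxt⟩ := exists_int_combination_of_det M (by
    rw [hdet, abs_div, abs_neg, abs_of_pos (by norm_num : (0 : ℝ) < 4)]
    linarith)
  rw [Fin.sum_univ_three] at ht
  have a0 := abs_le.mp (le_refl |t 0|)
  have a1 := abs_le.mp (le_refl |t 1|)
  have a2 := abs_le.mp (le_refl |t 2|)
  -- Adding `c` to all four coefficients leaves the point fixed and makes them barycentric; `∑ |t i|
  -- < 1` makes them nonnegative.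
  let c : ℝ := (1 - t 0 - t 1 - t 2) / 4
  obtain ⟨m, hm⟩ := h.exists_int_of_mem
    ![(t 0 + t 1) / 2 + c, (t 0 + t 2) / 2 + c, (t 1 + t 2) / 2 + c, c]
    (by
      intro i
      fin_cases i <;> simp [c] <;> linarith)
    (by
      simp [Fin.sum_univ_four, c]
      linarith)
    x
    (by
      intro j
      have h1 := congrFun hxt j
      have h2 : (r 3 j : ℝ) = -(r 0 j + r 1 j + r 2 j) := by exact_mod_cast h.apply_three j
      simp [Matrix.mulVec, dotProduct, Fin.sum_univ_three, hM, toReal] at h1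
      simp [Fin.sum_univ_four, h1, h2]
      ring)
  -- The coefficient differences are integers of absolute value below 1, hence zero. This excludes
  -- the vertices as well.
  have hz : ∀ (s : ℝ) (i : Fin 4), |s| < 1 → s = m i - m 3 → s = 0 := by
    intro s i h1 h2
    rw [h2] at h1 ⊢
    have h3 : |m i - m 3| < 1 := by exact_mod_cast h1
    rw [Int.abs_lt_one_iff] at h3
    exact_mod_cast h3
  have b0 := hz ((t 0 + t 1) / 2) 0 (abs_lt.mpr ⟨by linarith, by linarith⟩) (by simpa using hm 0)
  have b1 := hz ((t 0 + t 2) / 2) 1 (abs_lt.mpr ⟨by linarith, by linarith⟩) (by simpa using hm 1)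
  have b2 := hz ((t 1 + t 2) / 2) 2 (abs_lt.mpr ⟨by linarith, by linarith⟩) (by simpa using hm 2)
  refine hx (funext fun j => ?_)
  have h1 := congrFun hxt j
  have t0 : t 0 = 0 := by linarith
  have t1 : t 1 = 0 := by linarith
  have t2 : t 2 = 0 := by linarith
  simp [Matrix.mulVec, dotProduct, Fin.sum_univ_three, toReal, t0, t1, t2] at h1
  exact h1

/-! ### Lattice hulls, unimodular maps and nondegenerate simplices -/

theorem IsLatticePolytope.eq_latticeHull {d n : ℕ} {P : Set (Fin d → ℝ)} (hP : IsLatticePolytope P)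
    {a : Fin n → (Fin d → ℤ)} (ha : IsLatticePointList P a) : P = latticeHull a := by
  obtain ⟨S, rfl⟩ := hP
  have hr := ha.2
  apply Set.Subset.antisymm
  · refine convexHull_mono ?_
    rw [hr]
    rintro _ ⟨z, hz, rfl⟩
    exact ⟨subset_convexHull ℝ _ ⟨z, hz, rfl⟩, z, rfl⟩
  · refine convexHull_min ?_ (convex_convexHull ℝ _)
    rw [hr]
    exact Set.inter_subset_left

theorem ZEquivalent.symm {d : ℕ} {P Q : Set (Fin d → ℝ)} (h : ZEquivalent P Q) :
    ZEquivalent Q P := by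
  obtain ⟨t, h1, h2⟩ := h
  refine ⟨t.symm, ?_, ?_⟩
  · nth_rewrite 1 [← h1]
    rw [← Set.image_comp]
    simp
  · rw [← h2, ← Set.image_comp]
    simp

theorem zEquivalent_latticeHull_of_range_eq {d n m : ℕ} {a : Fin n → (Fin d → ℤ)}
    {b : Fin m → (Fin d → ℤ)} (U : Matrix (Fin d) (Fin d) ℤ) (hU : IsUnit U.det) (c : Fin d → ℤ)
    (h : Set.range a = Set.range fun i => U.mulVec (b i) + c) :
    ZEquivalent (latticeHull a) (latticeHull b) := by
  refine ZEquivalent.symm ?_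
  have h1 : U * U⁻¹ = 1 := Matrix.mul_nonsing_inv U hU
  have h2 : U⁻¹ * U = 1 := Matrix.nonsing_inv_mul U hU
  have g1 := congrArg (Int.castRingHom ℝ).mapMatrix h1
  have g2 := congrArg (Int.castRingHom ℝ).mapMatrix h2
  rw [map_mul, map_one] at g1 g2
  let L := Matrix.toLin'OfInv g2 g1
  let t : (Fin d → ℝ) ≃ᵃ[ℝ] (Fin d → ℝ) :=
    L.toAffineEquiv.trans (AffineEquiv.constVAdd ℝ (Fin d → ℝ) (toReal c))
  have ht : ∀ z : Fin d → ℤ, t (toReal z) = toReal (U.mulVec z + c) := by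
    intro z
    funext i
    simp [t, L, toReal, Matrix.mulVec, dotProduct, add_comm]
  refine ⟨t, ?_, ?_⟩
  · apply Set.Subset.antisymm
    · rintro _ ⟨_, ⟨z, rfl⟩, rfl⟩
      exact ⟨_, (ht z).symm⟩
    · rintro _ ⟨z, rfl⟩
      refine ⟨_, ⟨U⁻¹.mulVec (z - c), rfl⟩, ?_⟩
      rw [ht, Matrix.mulVec_mulVec, h1, Matrix.one_mulVec, sub_add_cancel]
  · have := AffineMap.image_convexHull t.toAffineMap (Set.range fun i => toReal (b i))
    unfold latticeHull
    refine this.trans ?_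
    rw [← Set.range_comp]
    congr 1
    have e : (t.toAffineMap ∘ fun i => toReal (b i)) = toReal ∘ fun i => U.mulVec (b i) + c := by
      funext i
      exact ht (b i)
    rw [e, Set.range_comp, ← h, ← Set.range_comp]
    rfl

/-- A left kernel vector of the matrix is an affine functional vanishing at all the points, hence on
the whole space, hence zero. -/
theorem simplexVolume_ne_zero_of_affineSpan_eq_top {d : ℕ} {p : Fin (d + 1) → (Fin d → ℤ)}
    (h : affineSpan ℝ (Set.range fun i => toReal (p i)) = ⊤) : simplexVolume p ≠ 0 := by
  unfold simplexVolume
  rw [ne_eq, abs_eq_zero]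
  intro h0
  obtain ⟨w, hw, hw0⟩ := Matrix.exists_vecMul_eq_zero_iff.mpr h0
  have hvan : ∀ x : Fin d → ℝ, (w 0 : ℝ) + ∑ i : Fin d, (w i.succ : ℝ) * x i = 0 := by
    intro x
    have hx : x ∈ affineSpan ℝ (Set.range fun i => toReal (p i)) := by simp [h]
    refine affineSpan_induction (p := fun x : Fin d → ℝ =>
      (w 0 : ℝ) + ∑ i : Fin d, (w i.succ : ℝ) * x i = 0) hx ?_ ?_
    · rintro _ ⟨j, rfl⟩
      have := congrFun hw0 j
      simp only [Matrix.vecMul, dotProduct, Fin.sum_univ_succ, Matrix.of_apply, Fin.cons_zero,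
        Fin.cons_succ, mul_one, Pi.zero_apply] at this
      simp only [toReal]
      exact_mod_cast this
    · intro c u v y hu hv hy
      simp only [vsub_eq_sub, vadd_eq_add, Pi.add_apply, Pi.smul_apply, Pi.sub_apply, smul_eq_mul]
      have : ∀ i : Fin d, (w i.succ : ℝ) * (c * (u i - v i) + y i) =
          c * (w i.succ * u i) - c * (w i.succ * v i) + w i.succ * y i := fun i => by ring
      simp_rw [this, Finset.sum_add_distrib, Finset.sum_sub_distrib, ← Finset.mul_sum]
      linear_combination c * hu - c * hv + hy
  apply hw
  have z0 : w 0 = 0 := by simpa using hvan 0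
  funext i
  refine Fin.cases z0 (fun i => ?_) i
  simpa [z0, Pi.single_apply] using hvan (Pi.single i 1)

theorem IsFullDimensional.exists_simplexVolume_ne_zero {d : ℕ} {a : Fin (d + 2) → (Fin d → ℤ)}
    (h : IsFullDimensional (latticeHull a)) :
    ∃ k : Fin (d + 2), simplexVolume (fun j => a (k.succAbove j)) ≠ 0 := by
  obtain ⟨p, hp, hpm⟩ := h
  have htop : affineSpan ℝ (Set.range fun i => toReal (a i)) = ⊤ := by
    rw [← affineSpan_convexHull, eq_top_iff,
      ← hp.affineSpan_eq_top_iff_card_eq_finrank_add_one.mpr (by simp)]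
    exact affineSpan_mono ℝ (Set.range_subset_iff.mpr hpm)
  obtain ⟨t, hta, hspan, hind⟩ := exists_affineIndependent ℝ (Fin d → ℝ)
    (Set.range fun i => toReal (a i))
  have : Finite t := (Set.finite_range _).subset hta
  have := Fintype.ofFinite t
  have hcard := hind.card_le_finrank_succ.trans (Nat.succ_le_succ (Submodule.finrank_le _))
  rw [Module.finrank_fin_fun] at hcard
  choose f hf using fun x : t => hta x.2
  -- An affinely independent spanning subset has at most `d + 1` points, so it leaves out some index
  -- of the `d + 2`.
  obtain ⟨k, hk⟩ : ∃ k, k ∉ Set.range f := by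
    by_contra! hcon
    have := (Fintype.card_le_of_surjective f hcon).trans hcard
    simp at this
  refine ⟨k, simplexVolume_ne_zero_of_affineSpan_eq_top ?_⟩
  rw [eq_top_iff, ← htop, ← hspan]
  refine affineSpan_mono ℝ fun x hx => ?_
  obtain ⟨j, hj⟩ := Fin.exists_succAbove_eq (x := f ⟨x, hx⟩) (y := k) (by
    rintro rfl
    exact hk ⟨_, rfl⟩)
  exact ⟨j, by simpa [hj] using hf ⟨x, hx⟩⟩

/-! ### Lattice points, volume vectors and widths of the two configurations -/

theorem AffineMap.le_of_mem_latticeHull {d n : ℕ} {a : Fin n → (Fin d → ℤ)}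
    (f : (Fin d → ℝ) →ᵃ[ℝ] ℝ) {c : ℝ} (h : ∀ i, f (toReal (a i)) ≤ c) {x : Fin d → ℝ}
    (hx : x ∈ latticeHull a) : f x ≤ c := by
  have : latticeHull a ⊆ f ⁻¹' Set.Iic c :=
    convexHull_min (by rintro _ ⟨i, rfl⟩; exact h i) ((convex_Iic c).affine_preimage f)
  exact this hx

theorem toReal_mem_latticeHull {d n : ℕ} (a : Fin n → (Fin d → ℤ)) (i : Fin n) :
    toReal (a i) ∈ latticeHull a :=
  subset_convexHull ℝ _ ⟨i, rfl⟩

theorem sum_mul_le_of_toReal_mem_latticeHull {d n : ℕ} {a : Fin n → (Fin d → ℤ)} (u : Fin d → ℤ)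
    {c : ℤ} (h : ∀ i, ∑ j, u j * a i j ≤ c) {x : Fin d → ℤ} (hx : toReal x ∈ latticeHull a) :
    ∑ j, u j * x j ≤ c := by
  let f : (Fin d → ℝ) →ᵃ[ℝ] ℝ :=
    (∑ j, (u j : ℝ) • (LinearMap.proj j : (Fin d → ℝ) →ₗ[ℝ] ℝ)).toAffineMap
  have hf : ∀ z : Fin d → ℤ, f (toReal z) = ((∑ j, u j * z j : ℤ) : ℝ) := by
    intro z
    simp [f, toReal]
  have := f.le_of_mem_latticeHull (c := c) (fun i => by rw [hf]; exact_mod_cast h i) hx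
  rw [hf] at this
  exact_mod_cast this

theorem isLatticePointList_latticeHull {d n : ℕ} {a : Fin n → (Fin d → ℤ)}
    (hinj : Function.Injective a)
    (h : ∀ x : Fin d → ℤ, toReal x ∈ latticeHull a → ∃ i, a i = x) :
    IsLatticePointList (latticeHull a) a := by
  refine ⟨hinj, Set.Subset.antisymm ?_ ?_⟩
  · rintro _ ⟨i, rfl⟩
    exact ⟨toReal_mem_latticeHull a i, a i, rfl⟩
  · rintro _ ⟨hx, x, rfl⟩
    obtain ⟨i, rfl⟩ := h x hx
    exact ⟨i, rfl⟩

theorem isLatticePointList_configOne : IsLatticePointList (latticeHull configOne) configOne := by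
  refine isLatticePointList_latticeHull (by decide) fun x hx => ?_
  -- The four functionals are the outer facet normals of the tetrahedron on the last four points.
  have h1 := sum_mul_le_of_toReal_mem_latticeHull ![-3, 3, 1] (c := 1) (by decide) hx
  have h2 := sum_mul_le_of_toReal_mem_latticeHull ![1, 3, -3] (c := 1) (by decide) hx
  have h3 := sum_mul_le_of_toReal_mem_latticeHull ![1, -5, 1] (c := 1) (by decide) hx
  have h4 := sum_mul_le_of_toReal_mem_latticeHull ![1, -1, 1] (c := 1) (by decide) hx
  simp [Fin.sum_univ_three] at h1 h2 h3 h4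
  have b0 : -3 ≤ x 0 := by omega
  have b1 : x 0 ≤ 2 := by omega
  have b2 : -5 ≤ x 1 := by omega
  have b3 : x 1 ≤ 5 := by omega
  have key : (x 0 = 0 ∧ x 1 = 0 ∧ x 2 = 0) ∨
      (x 0 = 1 ∧ x 1 = 0 ∧ x 2 = 0) ∨
      (x 0 = 0 ∧ x 1 = 0 ∧ x 2 = 1) ∨
      (x 0 = 1 ∧ x 1 = 1 ∧ x 2 = 1) ∨
      (x 0 = -2 ∧ x 1 = -1 ∧ x 2 = -2) := by
    generalize x 0 = p at *
    generalize x 1 = q at *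
    generalize x 2 = s at *
    clear hx
    interval_cases p <;> interval_cases q <;> omega
  have hext : ∀ i, configOne i 0 = x 0 ∧ configOne i 1 = x 1 ∧ configOne i 2 = x 2 → configOne i = x := by
    rintro i ⟨e0, e1, e2⟩
    funext j
    fin_cases j
    exacts [e0, e1, e2]
  rcases key with ⟨e0, e1, e2⟩ | ⟨e0, e1, e2⟩ | ⟨e0, e1, e2⟩ | ⟨e0, e1, e2⟩ | ⟨e0, e1, e2⟩
  · exact ⟨0, hext 0 (by rw [e0, e1, e2]; decide)⟩
  · exact ⟨1, hext 1 (by rw [e0, e1, e2]; decide)⟩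
  · exact ⟨2, hext 2 (by rw [e0, e1, e2]; decide)⟩
  · exact ⟨3, hext 3 (by rw [e0, e1, e2]; decide)⟩
  · exact ⟨4, hext 4 (by rw [e0, e1, e2]; decide)⟩

theorem isLatticePointList_configFive :
    IsLatticePointList (latticeHull configFive) configFive := by
  refine isLatticePointList_latticeHull (by decide) fun x hx => ?_
  -- Again the facet inequalities of the tetrahedron on the last four points.
  have h1 := sum_mul_le_of_toReal_mem_latticeHull ![-15, 6, 5] (c := 5) (by decide) hx
  have h2 := sum_mul_le_of_toReal_mem_latticeHull ![5, 2, -15] (c := 5) (by decide) hx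
  have h3 := sum_mul_le_of_toReal_mem_latticeHull ![5, -6, 5] (c := 5) (by decide) hx
  have h4 := sum_mul_le_of_toReal_mem_latticeHull ![5, -2, 5] (c := 5) (by decide) hx
  simp [Fin.sum_univ_three] at h1 h2 h3 h4
  have b0 : -3 ≤ x 0 := by omega
  have b1 : x 0 ≤ 2 := by omega
  have b2 : -5 ≤ x 1 := by omega
  have b3 : x 1 ≤ 5 := by omega
  have key : (x 0 = 0 ∧ x 1 = 0 ∧ x 2 = 0) ∨
      (x 0 = 1 ∧ x 1 = 0 ∧ x 2 = 0) ∨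
      (x 0 = 0 ∧ x 1 = 0 ∧ x 2 = 1) ∨
      (x 0 = 2 ∧ x 1 = 5 ∧ x 2 = 1) ∨
      (x 0 = -3 ∧ x 1 = -5 ∧ x 2 = -2) := by
    generalize x 0 = p at *
    generalize x 1 = q at *
    generalize x 2 = s at *
    clear hx
    interval_cases p <;> interval_cases q <;> omega
  have hext : ∀ i, configFive i 0 = x 0 ∧ configFive i 1 = x 1 ∧ configFive i 2 = x 2 → configFive i = x := by
    rintro i ⟨e0, e1, e2⟩
    funext j
    fin_cases j
    exacts [e0, e1, e2]
  rcases key with ⟨e0, e1, e2⟩ | ⟨e0, e1, e2⟩ | ⟨e0, e1, e2⟩ | ⟨e0, e1, e2⟩ | ⟨e0, e1, e2⟩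
  · exact ⟨0, hext 0 (by rw [e0, e1, e2]; decide)⟩
  · exact ⟨1, hext 1 (by rw [e0, e1, e2]; decide)⟩
  · exact ⟨2, hext 2 (by rw [e0, e1, e2]; decide)⟩
  · exact ⟨3, hext 3 (by rw [e0, e1, e2]; decide)⟩
  · exact ⟨4, hext 4 (by rw [e0, e1, e2]; decide)⟩

theorem isVolumeVector_configOne : IsVolumeVector configOne ![-4, 1, 1, 1, 1] := by
  refine ⟨⟨?_, ?_⟩, by unfold simplexVolume; decide +kernel⟩
  · simp [Fin.sum_univ_succ]
    norm_num
  · funext j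
    fin_cases j <;> simp [Fin.sum_univ_succ, configOne, toReal] <;> norm_num

theorem isVolumeVector_configFive : IsVolumeVector configFive ![-20, 5, 5, 5, 5] := by
  refine ⟨⟨?_, ?_⟩, by unfold simplexVolume; decide +kernel⟩
  · simp [Fin.sum_univ_succ]
    norm_num
  · funext j
    fin_cases j <;> simp [Fin.sum_univ_succ, configFive, toReal] <;> norm_num

theorem isIntegerFunctional_functionalXZ : IsIntegerFunctional functionalXZ := by
  rintro _ ⟨z, rfl⟩
  exact ⟨z 0 - z 2, by simp [functionalXZ, toReal]⟩

theorem hasWidthWrt_latticeHull {d n : ℕ} {a : Fin n → (Fin d → ℤ)} (f : (Fin d → ℝ) →ᵃ[ℝ] ℝ)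
    {M m : ℝ} (hM : ∀ i, f (toReal (a i)) ≤ M) (hm : ∀ i, m ≤ f (toReal (a i)))
    (hM' : ∃ i, f (toReal (a i)) = M) (hm' : ∃ i, f (toReal (a i)) = m) :
    HasWidthWrt (latticeHull a) f (M - m) := by
  obtain ⟨i, hi⟩ := hM'
  obtain ⟨j, hj⟩ := hm'
  refine ⟨M, m, ⟨⟨_, toReal_mem_latticeHull a i, hi⟩, ?_⟩,
    ⟨⟨_, toReal_mem_latticeHull a j, hj⟩, ?_⟩, rfl⟩
  · rintro _ ⟨x, hx, rfl⟩
    exact f.le_of_mem_latticeHull hM hx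
  · rintro _ ⟨x, hx, rfl⟩
    have := (-f).le_of_mem_latticeHull (c := -m) (fun i => by simpa using hm i) hx
    simpa using this

theorem hasWidthWrt_configOne : HasWidthWrt (latticeHull configOne) functionalXZ 2 := by
  have := hasWidthWrt_latticeHull (a := configOne) functionalXZ (M := 1) (m := -1)
    (by intro i; fin_cases i <;> simp [functionalXZ, configOne, toReal])
    (by intro i; fin_cases i <;> simp [functionalXZ, configOne, toReal])
    ⟨1, by simp [functionalXZ, configOne, toReal]⟩ ⟨2, by simp [functionalXZ, configOne, toReal]⟩
  norm_num at this
  exact this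

theorem hasWidthWrt_configFive : HasWidthWrt (latticeHull configFive) functionalXZ 2 := by
  have := hasWidthWrt_latticeHull (a := configFive) functionalXZ (M := 1) (m := -1)
    (by intro i; fin_cases i <;> simp [functionalXZ, configFive, toReal] <;> norm_num)
    (by intro i; fin_cases i <;> simp [functionalXZ, configFive, toReal] <;> norm_num)
    ⟨1, by simp [functionalXZ, configFive, toReal]⟩ ⟨2, by simp [functionalXZ, configFive, toReal]⟩
  norm_num at this
  exact this

/-- If the differences `a i - a i₀` for `i ∈ s` sum to zero and span `ℝ³`, then the values of a
non-constant integer functional at the `a i` differ by at least two. -/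
theorem two_le_of_hasWidthWrt {n : ℕ} {a : Fin n → (Fin 3 → ℤ)} {i₀ : Fin n}
    {s : Finset (Fin n)} (hsum : ∑ i ∈ s, (a i - a i₀) = 0)
    (hspan : ∀ u : Fin 3 → ℝ, (∀ i ∈ s, ∑ j, u j * ((a i j : ℝ) - a i₀ j) = 0) → u = 0)
    {f : (Fin 3 → ℝ) →ᵃ[ℝ] ℝ} (hf : IsIntegerFunctional f) (hf' : ∃ x y, f x ≠ f y) {w : ℝ}
    (hw : HasWidthWrt (latticeHull a) f w) : 2 ≤ w := by
  obtain ⟨M, m, ⟨-, hM⟩, ⟨-, hm⟩, rfl⟩ := hw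
  choose g hg using fun z : Fin 3 → ℤ => hf (toReal z) ⟨z, rfl⟩
  have hlin : ∀ i, ((g (a i) : ℝ) - g (a i₀)) = f.linear (toReal (a i - a i₀)) := by
    intro i
    rw [← hg, ← hg, ← vsub_eq_sub, ← AffineMap.linearMap_vsub]
    congr 1
    funext j
    simp [toReal]
  have hs0 : ∑ i ∈ s, (g (a i) - g (a i₀)) = 0 := by
    have : ∑ i ∈ s, ((g (a i) : ℝ) - g (a i₀)) = 0 := by
      simp_rw [hlin]
      rw [← map_sum]
      have h0 : ∑ i ∈ s, toReal (a i - a i₀) = 0 := by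
        funext j
        have := congrFun hsum j
        simp only [Finset.sum_apply, Pi.zero_apply] at this
        simp only [Finset.sum_apply, toReal, Pi.zero_apply]
        exact_mod_cast this
      rw [h0, map_zero]
    exact_mod_cast this
  have hne : ∃ i ∈ s, g (a i) - g (a i₀) ≠ 0 := by
    by_contra! hcon
    have hu := hspan (fun j => f.linear (Pi.single j 1)) (by
      intro i hi
      have h1 := hlin i
      have h2 : (g (a i) : ℝ) - g (a i₀) = 0 := by exact_mod_cast hcon i hi
      rw [h2, LinearMap.pi_apply_eq_sum_univ] at h1
      rw [h1]
      refine Finset.sum_congr rfl fun j _ => ?_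
      have e : (fun k => if j = k then (1 : ℝ) else 0) = Pi.single j 1 := by
        funext k
        simp [Pi.single_apply, eq_comm]
      rw [e]
      simp [toReal, mul_comm])
    obtain ⟨x, y, hxy⟩ := hf'
    apply hxy
    have h0 : f.linear = 0 := by
      refine LinearMap.pi_ext' fun j => LinearMap.ext_ring ?_
      simpa using congrFun hu j
    have := f.linearMap_vsub x y
    rw [h0] at this
    exact sub_eq_zero.mp (by simpa using this.symm)
  have hle : ∀ i, (g (a i) : ℝ) ≤ M ∧ m ≤ g (a i) := fun i =>
    ⟨by rw [← hg]; exact hM ⟨_, toReal_mem_latticeHull a i, rfl⟩,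
      by rw [← hg]; exact hm ⟨_, toReal_mem_latticeHull a i, rfl⟩⟩
  -- Integers with sum zero, not all zero: one is at least `1` and another at most `-1`.
  obtain ⟨k, -, hk⟩ := Finset.exists_pos_of_sum_zero_of_exists_nonzero _ hs0 hne
  obtain ⟨l, -, hl⟩ := Finset.exists_pos_of_sum_zero_of_exists_nonzero
    (fun i => -(g (a i) - g (a i₀))) (by rw [Finset.sum_neg_distrib, hs0, neg_zero])
    (by simpa only [ne_eq, neg_eq_zero] using hne)
  have h1 : (2 : ℝ) ≤ g (a k) - g (a l) := by
    have : 2 ≤ g (a k) - g (a l) := by omega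
    exact_mod_cast this
  linarith [(hle k).1, (hle l).2]

theorem hasWidth_two_of_hasWidthWrt_functionalXZ {n : ℕ} {a : Fin n → (Fin 3 → ℤ)}
    (h2 : HasWidthWrt (latticeHull a) functionalXZ 2)
    {i₀ : Fin n} {s : Finset (Fin n)} (hsum : ∑ i ∈ s, (a i - a i₀) = 0)
    (hspan : ∀ u : Fin 3 → ℝ, (∀ i ∈ s, ∑ j, u j * ((a i j : ℝ) - a i₀ j) = 0) → u = 0) :
    HasWidth (latticeHull a) 2 := by
  refine ⟨⟨functionalXZ, isIntegerFunctional_functionalXZ, ⟨Pi.single 0 1, 0, ?_⟩, h2⟩, ?_⟩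
  · simp [functionalXZ]
  · rintro w ⟨f, hf, hf', hw⟩
    exact two_le_of_hasWidthWrt hsum hspan hf hf' hw

theorem hasWidth_configOne : HasWidth (latticeHull configOne) 2 := by
  refine hasWidth_two_of_hasWidthWrt_functionalXZ hasWidthWrt_configOne (i₀ := 0)
    (s := {1, 2, 3, 4}) (by decide) fun u hu => ?_
  have h1 := hu 1 (by simp)
  have h2 := hu 2 (by simp)
  have h3 := hu 3 (by simp)
  simp [configOne, Fin.sum_univ_three] at h1 h2 h3
  funext j
  fin_cases j <;> simp <;> linarith

theorem hasWidth_configFive : HasWidth (latticeHull configFive) 2 := by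
  refine hasWidth_two_of_hasWidthWrt_functionalXZ hasWidthWrt_configFive (i₀ := 0)
    (s := {1, 2, 3, 4}) (by decide) fun u hu => ?_
  have h1 := hu 1 (by simp)
  have h2 := hu 2 (by simp)
  have h3 := hu 3 (by simp)
  simp [configFive, Fin.sum_univ_three] at h1 h2 h3
  funext j
  fin_cases j <;> simp <;> linarith

/-! ### Classification of centred simplices -/

theorem det_cons_one (p : Fin 4 → Fin 3 → ℤ) :
    (Matrix.of fun i => (Fin.cons 1 (p i) : Fin 4 → ℤ)).det =
      -(Matrix.of ![p 0 - p 3, p 1 - p 3, p 2 - p 3]).det := by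
  have h : (Matrix.of fun i => (Fin.cons 1 (p i) : Fin 4 → ℤ)) =
      !![1, p 0 0, p 0 1, p 0 2; 1, p 1 0, p 1 1, p 1 2; 1, p 2 0, p 2 1, p 2 2;
        1, p 3 0, p 3 1, p 3 2] := by
    ext i j
    fin_cases i <;> fin_cases j <;> rfl
  rw [h, Matrix.det_fin_three, Matrix.det_succ_row_zero]
  simp [Matrix.det_fin_three, Fin.sum_univ_four, Fin.succAbove]
  ring

theorem det_cons_one_of_sum_eq_zero {r : Fin 4 → Fin 3 → ℤ} (h : ∑ i, r i = 0) :
    (Matrix.of fun i => (Fin.cons 1 (r i) : Fin 4 → ℤ)).det =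
      -4 * (Matrix.of ![r 0, r 1, r 2]).det := by
  have h3 : ∀ j, r 3 j = -(r 0 j + r 1 j + r 2 j) := by
    intro j
    have := congrFun h j
    simp [Fin.sum_univ_four] at this
    linarith
  rw [det_cons_one, Matrix.det_fin_three, Matrix.det_fin_three]
  simp [h3]
  ring

namespace IsCentredSimplex

variable {r : Fin 4 → Fin 3 → ℤ}

/-- Up to the factor `-4`, the determinant of three of the vectors is the determinant with rows `(1,
rᵢ)`, in which all four play the same role. -/
theorem abs_det_perm (h : IsCentredSimplex r) (σ : Equiv.Perm (Fin 4)) :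
    |(Matrix.of ![r (σ 0), r (σ 1), r (σ 2)]).det| = |(Matrix.of ![r 0, r 1, r 2]).det| := by
  have h1 := det_cons_one_of_sum_eq_zero h.sum_eq_zero
  have h2 := det_cons_one_of_sum_eq_zero (r := r ∘ σ)
    ((Equiv.sum_comp σ r).trans h.sum_eq_zero)
  have h3 := Matrix.det_permute σ (Matrix.of fun i => (Fin.cons 1 (r i) : Fin 4 → ℤ))
  have h4 : (Matrix.of fun i => (Fin.cons 1 (r i) : Fin 4 → ℤ)).submatrix σ id =
    Matrix.of fun i => (Fin.cons 1 ((r ∘ σ) i) : Fin 4 → ℤ) := rfl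
  rw [h4, h2, h1] at h3
  simp only [Function.comp_apply] at h3
  rcases Int.units_eq_one_or (Equiv.Perm.sign σ) with h5 | h5 <;> rw [h5] at h3
  · congr 1
    push_cast at h3
    linarith
  · rw [← abs_neg]
    congr 1
    push_cast at h3
    linarith

theorem abs_det_eq_one_or_five (h : IsCentredSimplex r) :
    |(Matrix.of ![r 0, r 1, r 2]).det| = 1 ∨ |(Matrix.of ![r 0, r 1, r 2]).det| = 5 := by
  obtain ⟨n, hn⟩ := Int.eq_ofNat_of_zero_le (abs_nonneg (Matrix.of ![r 0, r 1, r 2]).det)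
  have hle := h.abs_det_le
  have hne := abs_pos.mpr h.det_ne_zero
  have hfive : ∀ p : ℕ, p.Prime → p ∣ n → p = 5 := by
    intro p hp hpn
    refine h.eq_five_of_prime_dvd hp ?_ ?_
    · have := Nat.le_of_dvd (by omega) hpn
      omega
    · rw [← dvd_abs, hn]
      exact_mod_cast hpn
  rw [hn] at hle hne ⊢
  norm_cast at hle hne ⊢
  obtain ⟨k, rfl⟩ : ∃ k, n = 5 ^ k := ⟨_, Nat.eq_prime_pow_of_unique_prime_dvd hne.ne' (hfive _)⟩
  rcases k with _ | _ | k
  · simp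
  · simp
  · have := Nat.one_le_pow k 5 (by norm_num)
    rw [pow_add] at hle
    omega

end IsCentredSimplex

/-- Matches the two orders: the centre is listed last in `a`, while `τ` and `σ` say where the centre
and the vertices occur in `b`. -/
theorem range_fin_five_eq {r : Fin 4 → Fin 3 → ℤ} {a b : Fin 5 → Fin 3 → ℤ}
    (U : Matrix (Fin 3) (Fin 3) ℤ) (σ : Equiv.Perm (Fin 4)) (τ : Equiv.Perm (Fin 5))
    (hr : ∀ i, a (Fin.castSucc i) = r i + a 4) (h4 : U.mulVec (b (τ 4)) = 0)
    (hU : ∀ i : Fin 4, U.mulVec (b (τ i.castSucc)) = r (σ i)) :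
    Set.range a = Set.range fun i => U.mulVec (b i) + a 4 := by
  apply Set.Subset.antisymm
  · rintro _ ⟨i, rfl⟩
    refine Fin.lastCases ?_ (fun i => ?_) i
    · exact ⟨τ 4, by simp only [h4, zero_add]; rfl⟩
    · exact ⟨τ (σ.symm i).castSucc, by simp [hU, hr]⟩
  · rintro _ ⟨i, rfl⟩
    obtain ⟨i, rfl⟩ := τ.surjective i
    refine Fin.lastCases ?_ (fun i => ?_) i
    · exact ⟨4, by
        change a 4 = U.mulVec (b (τ 4)) + a 4
        rw [h4, zero_add]⟩
    · exact ⟨(σ i).castSucc, by simp only [hU, hr]⟩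

namespace IsCentredSimplex

variable {r : Fin 4 → Fin 3 → ℤ} {a : Fin 5 → Fin 3 → ℤ}

theorem zEquivalent_configOne (h : IsCentredSimplex r)
    (hd : |(Matrix.of ![r 0, r 1, r 2]).det| = 1) (hr : ∀ i, a (Fin.castSucc i) = r i + a 4) :
    ZEquivalent (latticeHull a) (latticeHull configOne) := by
  -- The columns are forced by `(1,0,0) ↦ r 0`, `(0,0,1) ↦ r 1` and `(1,1,1) ↦ r 2`.
  let U : Matrix (Fin 3) (Fin 3) ℤ := Matrix.of fun j => ![r 0 j, r 2 j - r 0 j - r 1 j, r 1 j]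
  have hU : U.det = -(Matrix.of ![r 0, r 1, r 2]).det := by
    simp [U, Matrix.det_fin_three]
    ring
  have h3 := h.apply_three
  refine zEquivalent_latticeHull_of_range_eq U ?_ (a 4)
    (range_fin_five_eq (r := r) U 1 (finRotate 5) hr ?_ ?_)
  · rw [hU, Int.isUnit_iff_abs_eq, abs_neg, hd]
  · funext j
    simp [configOne, Matrix.mulVec, dotProduct, Fin.sum_univ_three]
  · intro i
    funext j
    fin_cases i <;>
      simp [configOne, Matrix.mulVec, dotProduct, Fin.sum_univ_three, U, h3] <;> ring

theorem zEquivalent_configFive (h : IsCentredSimplex r)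
    (hd : |(Matrix.of ![r 0, r 1, r 2]).det| = 5) (hr : ∀ i, a (Fin.castSucc i) = r i + a 4) :
    ZEquivalent (latticeHull a) (latticeHull configFive) := by
  obtain ⟨σ, x, hx⟩ := h.exists_perm_relation_five (by
    rw [← dvd_abs, hd])
  -- The vector `x` completes `r (σ 0)` and `r (σ 1)` to a lattice basis. In it `r (σ 3)` and `r (σ
  -- 2)` have the coordinates of the last two points of `configFive`, in that order; hence the swap
  -- below.
  let U : Matrix (Fin 3) (Fin 3) ℤ := Matrix.of fun j => ![r (σ 0) j, x j, r (σ 1) j]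
  have hsum : ∀ j, r (σ 0) j + r (σ 1) j + r (σ 2) j + r (σ 3) j = 0 := by
    intro j
    have := congrFun ((Equiv.sum_comp σ r).trans h.sum_eq_zero) j
    simpa [Fin.sum_univ_four] using this
  have h5x : ∀ j, r (σ 1) j + 2 * r (σ 2) j + 3 * r (σ 3) j = 5 * x j := by
    intro j
    simpa using congrFun hx j
  have e2 : ∀ j, r (σ 2) j = -3 * r (σ 0) j - 5 * x j - 2 * r (σ 1) j := by
    intro j
    linarith [hsum j, h5x j]
  have e3 : ∀ j, r (σ 3) j = 2 * r (σ 0) j + 5 * x j + r (σ 1) j := by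
    intro j
    linarith [hsum j, h5x j]
  have hU : 5 * U.det = (Matrix.of ![r (σ 0), r (σ 1), r (σ 2)]).det := by
    simp [U, Matrix.det_fin_three, e2]
    ring
  have hU' : 5 * |U.det| = 5 := by
    have := congrArg abs hU
    rwa [abs_mul, h.abs_det_perm σ, hd] at this
  refine zEquivalent_latticeHull_of_range_eq U ?_ (a 4)
    (range_fin_five_eq (r := r) U (σ * Equiv.swap 2 3) (finRotate 5) hr ?_ ?_)
  · rw [Int.isUnit_iff_abs_eq]
    linarith
  · funext j
    simp [configFive, Matrix.mulVec, dotProduct, Fin.sum_univ_three]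
  · intro i
    funext j
    have s0 : (Equiv.swap 2 3 : Equiv.Perm (Fin 4)) 0 = 0 := by decide
    have s1 : (Equiv.swap 2 3 : Equiv.Perm (Fin 4)) 1 = 1 := by decide
    fin_cases i <;>
      simp [configFive, Matrix.mulVec, dotProduct, Fin.sum_univ_three, U, e2, e3, s0, s1] <;> ring

end IsCentredSimplex

/-! ### From polytopes to centred simplices -/

theorem isCentredSimplex_of_latticePointList {a : Fin 5 → (Fin 3 → ℤ)}
    (ha : IsLatticePointList (latticeHull a) a)
    (hsum : ∑ i : Fin 4, (a i.castSucc - a 4) = 0)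
    (hdet : (Matrix.of ![a 0 - a 4, a 1 - a 4, a 2 - a 4]).det ≠ 0) :
    IsCentredSimplex fun i : Fin 4 => a i.castSucc - a 4 where
  sum_eq_zero := hsum
  det_ne_zero := hdet
  eq_of_mem := by
    intro x hx
    have hsub : convexHull ℝ (Set.range fun i : Fin 4 => toReal (a i.castSucc - a 4)) ⊆
        (fun y => y + toReal (a 4)) ⁻¹' latticeHull a := by
      refine convexHull_min ?_ ((convex_convexHull ℝ _).translate_preimage_left _)
      rintro _ ⟨i, rfl⟩
      refine subset_convexHull ℝ _ ⟨i.castSucc, ?_⟩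
      funext j
      simp [toReal]
    have hmem : toReal (x + a 4) ∈ latticeHull a ∩ intLattice 3 := by
      refine ⟨?_, _, rfl⟩
      have h1 : toReal (x + a 4) = toReal x + toReal (a 4) := by
        funext j
        simp [toReal]
      rw [h1]
      exact hsub hx
    rw [← ha.2] at hmem
    obtain ⟨k, hk⟩ := hmem
    have hk' : a k = x + a 4 := by
      funext j
      have := congrFun hk j
      simp only [toReal] at this
      exact_mod_cast this
    revert hk'
    refine Fin.lastCases (fun hk' => Or.inl ?_) (fun i hk' => Or.inr ⟨i, ?_⟩) k
    · exact add_eq_right.mp hk'.symm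
    · rw [hk', add_sub_cancel_right]

theorem simplexVolume_succAbove_three (a : Fin 5 → (Fin 3 → ℤ)) :
    simplexVolume (fun j => a ((3 : Fin 5).succAbove j)) =
      |(Matrix.of ![a 0 - a 4, a 1 - a 4, a 2 - a 4]).det| := by
  have e0 : (3 : Fin 5).succAbove 0 = 0 := by decide
  have e1 : (3 : Fin 5).succAbove 1 = 1 := by decide
  have e2 : (3 : Fin 5).succAbove 2 = 2 := by decide
  have e3 : (3 : Fin 5).succAbove 3 = 4 := by decide
  have h := det_cons_one fun j => a ((3 : Fin 5).succAbove j)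
  rw [← Matrix.det_transpose] at h
  unfold simplexVolume
  refine (congrArg abs h).trans ?_
  rw [abs_neg, e0, e1, e2, e3]

theorem zEquivalent_of_hasVolumeVector {P : Set (Fin 3 → ℝ)} {q : ℕ} (hP : IsLatticePolytope P)
    (hfull : IsFullDimensional P) (hv : HasVolumeVector P ![(q : ℤ), q, q, q, -4 * q]) :
    (q = 1 ∧ ZEquivalent P (latticeHull configOne)) ∨
      (q = 5 ∧ ZEquivalent P (latticeHull configFive)) := by
  obtain ⟨a, ha, ⟨-, hdep⟩, hvol⟩ := hv
  obtain rfl := hP.eq_latticeHull ha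
  -- If `q = 0`, every four of the points would be coplanar, against full dimension.
  have hq : (q : ℤ) ≠ 0 := by
    rintro hq
    obtain ⟨k, hk⟩ := hfull.exists_simplexVolume_ne_zero
    rw [← hvol k, hq] at hk
    fin_cases k <;> simp at hk
  have hdet : |(Matrix.of ![a 0 - a 4, a 1 - a 4, a 2 - a 4]).det| = q := by
    rw [← simplexVolume_succAbove_three, ← hvol 3]
    simp
  have hc : IsCentredSimplex fun i : Fin 4 => a i.castSucc - a 4 := by
    refine isCentredSimplex_of_latticePointList ha ?_ ?_
    · funext j
      have h1 := congrFun hdep j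
      simp [Fin.sum_univ_five, toReal] at h1
      have h2 : (q : ℤ) * (a 0 j + a 1 j + a 2 j + a 3 j - 4 * a 4 j) = 0 := by
        have : (q : ℝ) * (a 0 j + a 1 j + a 2 j + a 3 j - 4 * a 4 j) = 0 := by linarith
        exact_mod_cast this
      have h3 := (mul_eq_zero.mp h2).resolve_left hq
      simp [Fin.sum_univ_four]
      linarith
    · rw [← abs_ne_zero, hdet]
      exact hq
  rcases hc.abs_det_eq_one_or_five with h | h
  · exact Or.inl ⟨by exact_mod_cast hdet.symm.trans h,
      hc.zEquivalent_configOne h fun i => (sub_add_cancel _ _).symm⟩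
  · exact Or.inr ⟨by exact_mod_cast hdet.symm.trans h,
      hc.zEquivalent_configFive h fun i => (sub_add_cancel _ _).symm⟩

theorem mainTheorem10 :
    (∀ (P : Set (Fin 3 → ℝ)) (q : ℕ),
      IsLatticePolytope P → IsFullDimensional P → latticeSize P = 5 → HasSignature P 4 1 →
      HasVolumeVector P ![(q : ℤ), q, q, q, -4 * q] →
        (q = 1 ∧ ZEquivalent P (latticeHull configOne)) ∨
        (q = 5 ∧ ZEquivalent P (latticeHull configFive))) ∧
    (IsLatticePointList (latticeHull configOne) configOne ∧
      IsVolumeVector configOne ![-4, 1, 1, 1, 1]) ∧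
    (IsLatticePointList (latticeHull configFive) configFive ∧
      IsVolumeVector configFive ![-20, 5, 5, 5, 5]) ∧
    (IsIntegerFunctional functionalXZ ∧
      HasWidthWrt (latticeHull configOne) functionalXZ 2 ∧
      HasWidthWrt (latticeHull configFive) functionalXZ 2) ∧
    HasWidth (latticeHull configOne) 2 ∧ HasWidth (latticeHull configFive) 2 := by
  refine ⟨fun P q hP hfull _ _ hv => zEquivalent_of_hasVolumeVector hP hfull hv,
    ⟨isLatticePointList_configOne, isVolumeVector_configOne⟩,
    ⟨isLatticePointList_configFive, isVolumeVector_configFive⟩,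
    ⟨isIntegerFunctional_functionalXZ, hasWidthWrt_configOne, hasWidthWrt_configFive⟩,
    hasWidth_configOne, hasWidth_configFive⟩
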